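/- Let $n$ be a natural number, let $p>0$ be real, and let $A,B$ be positive semidefinite $n\times n$ complex matrices. Let $|||\cdot|||$ be any unitarily invariant norm on the space $\mathbb{M}_n(\mathbb{C})$ of $n\times n$ complex matrices, that is, a norm on this complex vector space with $|||UXV|||=|||X|||$ for all $X\in\mathbb{M}_n(\mathbb{C})$ and all unitary matrices $U,V\in\mathbb{M}_n(\mathbb{C})$. Then $$ \bigl|\bigl|\bigl|\,(A^{p/4}B^{p/2}A^{p/4})^{1/p}\,\bigr|\bigr|\bigr|\;\le\;|||A|||^{1/2}\,|||B|||^{1/2}\;\le\;\frac{|||A|||+|||B|||}{2}, $$ where the real powers of positive semidefinite matrices are defined by the functional calculus on $[0,\infty)$. -/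

import Mathlib

open scoped MatrixOrder ComplexOrder

/-- A unitarily invariant norm on the space of `n × n` complex matrices: a norm on this complex
vector space with `‖U X V‖ = ‖X‖` for all unitary `U`, `V`. (A `Seminorm` is real valued,
nonnegative, subadditive and absolutely homogeneous.) -/
structure IsUnitarilyInvariantNorm {n : ℕ} (N : Seminorm ℂ (Matrix (Fin n) (Fin n) ℂ)) :
    Prop where
  eq_zero_of_map_eq_zero : ∀ X : Matrix (Fin n) (Fin n) ℂ, N X = 0 → X = 0
  map_unitary_mul_mul : ∀ U ∈ Matrix.unitaryGroup (Fin n) ℂ,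
    ∀ V ∈ Matrix.unitaryGroup (Fin n) ℂ, ∀ X : Matrix (Fin n) (Fin n) ℂ, N (U * X * V) = N X

/-- The mean `(A^{p/4} B^{p/2} A^{p/4})^{1/p}` of positive semidefinite matrices; the real powers
are those of the continuous functional calculus (`CFC.rpow`). -/
noncomputable def kappaMean {n : ℕ} (p : ℝ) (A B : Matrix (Fin n) (Fin n) ℂ) :
    Matrix (Fin n) (Fin n) ℂ :=
  (A ^ (p / 4) * B ^ (p / 2) * A ^ (p / 4)) ^ (1 / p)

/-! Let `a`, `b`, `g` be the decreasing eigenvalues of `A`, `B` and `G = A^{p/4} B^{p/2} A^{p/4}`.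
Horn's inequality, obtained from Cauchy–Binet, bounds the product of the top `k` values of `g` by
that of `(a_j b_j)^{p/2}`. Taking `1/p`-th powers, the eigenvalues of the mean are weakly
log-majorized by `√(a_j b_j)`, hence by `(t a_j + t⁻¹ b_j) / 2` for every `t > 0`. Ky Fan dominance
turns this into `N (kappaMean p A B) ≤ (t N A + t⁻¹ N B) / 2`, since the majorant is a combination
of two diagonal matrices with the norms of `A` and `B`. Optimizing over `t` gives the geometric
mean, so no Cauchy–Schwarz inequality for `N` is needed. The second inequality is scalar AM–GM. -/

open Finset

/-! ### Decreasing sequences and weak log-majorization -/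

namespace Fin

theorem val_le_of_strictMono {k n : ℕ} {g : Fin k → Fin n} (hg : StrictMono g) (j : Fin k) :
    (j : ℕ) ≤ g j := by
  obtain ⟨j, hj⟩ := j
  induction j with
  | zero => simp
  | succ j ih =>
    have h1 := ih (by omega)
    have h2 : g ⟨j, by omega⟩ < g ⟨j + 1, hj⟩ := hg (by simp)
    have h3 : (g ⟨j, by omega⟩ : ℕ) < g ⟨j + 1, hj⟩ := h2
    simp only at h1 ⊢
    omega

theorem prod_comp_le_prod_castLE {k n : ℕ} (hk : k ≤ n) {p : Fin n → ℝ} (hp : Antitone p)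
    (hp0 : ∀ i, 0 ≤ p i) {f : Fin k → Fin n} (hf : Function.Injective f) :
    ∏ j, p (f j) ≤ ∏ j : Fin k, p (castLE hk j) := by
  have hs : StrictMono (f ∘ Tuple.sort f) :=
    (Tuple.monotone_sort f).strictMono_of_injective (hf.comp (Tuple.sort f).injective)
  rw [← Equiv.prod_comp (Tuple.sort f) (fun j => p (f j))]
  refine Finset.prod_le_prod (fun j _ => hp0 _) fun j _ => hp ?_
  exact val_le_of_strictMono hs j

end Fin

/-- Summation by parts: an antitone nonnegative weight keeps the sign of sums whose partial sums
are nonnegative. -/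
theorem sum_mul_nonneg_of_partial_sums {n : ℕ} {w x : Fin n → ℝ} (hw : Antitone w)
    (hw0 : ∀ i, 0 ≤ w i)
    (hx : ∀ k (hk : k ≤ n), 0 ≤ ∑ j : Fin k, x (Fin.castLE hk j)) :
    0 ≤ ∑ i, w i * x i := by
  induction n with
  | zero => simp
  | succ n ih =>
    -- Subtracting the smallest weight keeps the others antitone and nonnegative; what is removed
    -- multiplies the full sum.
    have h1 : 0 ≤ ∑ i : Fin n, (w i.castSucc - w (Fin.last n)) * x i.castSucc := by
      refine ih (w := fun i => w i.castSucc - w (Fin.last n)) (x := fun i => x i.castSucc)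
        (fun i j hij => ?_) (fun i => ?_) fun k hk => ?_
      · exact sub_le_sub_right (hw (Fin.castSucc_le_castSucc_iff.2 hij)) _
      · exact sub_nonneg.2 (hw (Fin.le_last _))
      · exact hx k (by omega)
    have h2 : 0 ≤ w (Fin.last n) * ∑ i, x i := mul_nonneg (hw0 _) (hx (n + 1) le_rfl)
    have h3 : ∑ i, w i * x i = ∑ i : Fin n, (w i.castSucc - w (Fin.last n)) * x i.castSucc
        + w (Fin.last n) * ∑ i, x i := by
      simp only [Fin.sum_univ_castSucc, sub_mul, sum_sub_distrib, mul_add, mul_sum]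
      ring
    rw [h3]
    exact add_nonneg h1 h2

/-- Weak log-majorization implies weak majorization, in weighted form. -/
theorem sum_mul_le_sum_mul_of_prod_le {n : ℕ} {w x y : Fin n → ℝ} (hw : Antitone w)
    (hw0 : ∀ i, 0 ≤ w i) (hx : Antitone x) (hx0 : ∀ i, 0 ≤ x i) (hy0 : ∀ i, 0 ≤ y i)
    (h : ∀ k (hk : k ≤ n), ∏ j : Fin k, x (Fin.castLE hk j) ≤ ∏ j : Fin k, y (Fin.castLE hk j)) :
    ∑ i, w i * x i ≤ ∑ i, w i * y i := by
  -- The zeros of `x` form a tail; the value 0 there leaves the partial sums of `l` unchanged.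
  set l : Fin n → ℝ := fun j => if x j = 0 then 0 else Real.log (y j / x j) with hl
  have hpos : ∀ k (hk : k + 1 ≤ n), x (Fin.castLE hk (Fin.last k)) ≠ 0 →
      ∀ j : Fin (k + 1), 0 < x (Fin.castLE hk j) ∧ 0 < y (Fin.castLE hk j) := by
    intro k hk hne j
    have hx1 : ∀ j : Fin (k + 1), 0 < x (Fin.castLE hk j) := fun j =>
      lt_of_lt_of_le (lt_of_le_of_ne (hx0 _) hne.symm)
        (hx ((Fin.castLE_le_castLE_iff hk).2 (Fin.le_last j)))
    refine ⟨hx1 j, lt_of_le_of_ne (hy0 _) fun h0 => ?_⟩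
    have h1 := h (k + 1) hk
    rw [prod_eq_zero (f := fun j => y (Fin.castLE hk j)) (mem_univ j) h0.symm] at h1
    exact absurd (prod_pos fun j _ => hx1 j) (not_lt.2 h1)
  have hlsum : ∀ k (hk : k ≤ n), 0 ≤ ∑ j : Fin k, l (Fin.castLE hk j) := by
    intro k
    induction k with
    | zero => simp
    | succ k ih =>
      intro hk
      by_cases h0 : x (Fin.castLE hk (Fin.last k)) = 0
      · rw [Fin.sum_univ_castSucc]
        have h1 : l (Fin.castLE hk (Fin.last k)) = 0 := if_pos h0
        rw [h1, add_zero]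
        exact ih (by omega)
      · have hp := hpos k hk h0
        have h1 : ∑ j : Fin (k + 1), l (Fin.castLE hk j)
            = Real.log (∏ j : Fin (k + 1), y (Fin.castLE hk j) / x (Fin.castLE hk j)) := by
          rw [Real.log_prod fun j _ => (div_pos (hp j).2 (hp j).1).ne']
          exact sum_congr rfl fun j _ => if_neg (hp j).1.ne'
        rw [h1, prod_div_distrib]
        exact Real.log_nonneg ((one_le_div (prod_pos fun j _ => (hp j).1)).2 (h _ hk))
  have key : 0 ≤ ∑ i, (w i * x i) * l i :=
    sum_mul_nonneg_of_partial_sums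
      (fun i j hij => mul_le_mul (hw hij) (hx hij) (hx0 _) (hw0 _))
      (fun i => mul_nonneg (hw0 i) (hx0 i)) hlsum
  -- This is `x log (y / x) ≤ y - x`, from `log r ≤ r - 1`.
  have hpt : ∀ i, (w i * x i) * l i ≤ w i * y i - w i * x i := by
    intro i
    by_cases h0 : x i = 0
    · simp [h0, mul_nonneg (hw0 i) (hy0 i)]
    · have hp := hpos i i.2 h0 (Fin.last i)
      have hxi : 0 < x i := hp.1
      have hyi : 0 < y i := hp.2
      have h1 : l i = Real.log (y i / x i) := if_neg h0
      have h2 := Real.log_le_sub_one_of_pos (div_pos hyi hxi)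
      have h3 : x i * (y i / x i - 1) = y i - x i := by field_simp
      calc w i * x i * l i ≤ w i * x i * (y i / x i - 1) := by
            rw [h1]; exact mul_le_mul_of_nonneg_left h2 (mul_nonneg (hw0 i) (hx0 i))
        _ = w i * y i - w i * x i := by rw [mul_assoc, h3, mul_sub]
  have := key.trans (sum_le_sum fun i _ => hpt i)
  rw [sum_sub_distrib] at this
  linarith

/-! ### Cauchy–Binet and Horn's inequality -/

namespace Matrix

section CauchyBinet

variable {m ι R : Type*} [Fintype m] [DecidableEq m] [Fintype ι] [CommRing R]

theorem det_mul_eq_sum_prod_mul_det (P : Matrix m ι R) (Q : Matrix ι m R) :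
    (P * Q).det = ∑ f : m → ι, (∏ i, P i (f i)) * (Q.submatrix f id).det := by
  have h : P * Q = fun i => ∑ l, P i l • Q l := by
    ext i j
    simp [mul_apply]
  calc (P * Q).det = detRowAlternating (fun i => ∑ l, P i l • Q l) := by rw [h]; rfl
    _ = ∑ f : m → ι, detRowAlternating (fun i => P i (f i) • Q (f i)) :=
        (detRowAlternating (R := R) (n := m)).toMultilinearMap.map_sum
          (fun i l => P i l • Q l)
    _ = _ := by
        refine sum_congr rfl fun f _ => ?_
        exact (detRowAlternating (R := R) (n := m)).toMultilinearMap.map_smul_univ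
          (fun i => P i (f i)) (fun i => Q (f i))

/-- The Cauchy–Binet formula, as a sum over all maps instead of all subsets of columns. -/
theorem factorial_mul_det_mul (P : Matrix m ι R) (Q : Matrix ι m R) :
    ((Fintype.card m).factorial : R) * (P * Q).det
      = ∑ f : m → ι, (P.submatrix id f).det * (Q.submatrix f id).det := by
  -- Reindexing `f` by `σ` produces a second sign that cancels the first, so all the terms of the
  -- Leibniz expansion contribute equally.
  have key : ∀ σ : Equiv.Perm m,
      ∑ f : m → ι, ((Equiv.Perm.sign σ : ℤ) : R) * (∏ i, P (σ i) (f i)) * (Q.submatrix f id).det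
        = (P * Q).det := by
    intro σ
    rw [det_mul_eq_sum_prod_mul_det, ← Equiv.sum_comp (σ.symm.arrowCongr (Equiv.refl ι))]
    refine sum_congr rfl fun g _ => ?_
    have h1 : (Q.submatrix (σ.symm.arrowCongr (Equiv.refl ι) g) id).det
        = ((Equiv.Perm.sign σ : ℤ) : R) * (Q.submatrix g id).det := by
      rw [← det_permute]; rfl
    have h2 : ∏ i, P (σ i) (σ.symm.arrowCongr (Equiv.refl ι) g i) = ∏ i, P i (g i) :=
      Equiv.prod_comp σ (fun i => P i (g i))
    have h3 : ((Equiv.Perm.sign σ : ℤ) : R) * ((Equiv.Perm.sign σ : ℤ) : R) = 1 := by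
      rw [← Int.cast_mul, Int.units_coe_mul_self, Int.cast_one]
    rw [h1, h2]
    linear_combination (∏ i, P i (g i)) * (Q.submatrix g id).det * h3
  simp_rw [det_apply' (P.submatrix id _), sum_mul]
  rw [sum_comm]
  simp only [submatrix_apply, id_eq]
  rw [sum_congr rfl fun σ _ => key σ]
  simp [Fintype.card_perm]

end CauchyBinet

theorem factorial_mul_det_conjTranspose_mul_diagonal_mul {k n : ℕ} (p : Fin n → ℝ)
    (M : Matrix (Fin n) (Fin k) ℂ) :
    (k.factorial : ℂ) * (Mᴴ * diagonal (fun i => (p i : ℂ)) * M).det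
      = ((∑ f : Fin k → Fin n, (∏ j, p (f j)) * Complex.normSq (M.submatrix f id).det : ℝ) : ℂ)
      := by
  have h := factorial_mul_det_mul (Mᴴ * diagonal (fun i => (p i : ℂ))) M
  rw [Fintype.card_fin] at h
  rw [h, Complex.ofReal_sum]
  refine sum_congr rfl fun f _ => ?_
  have h1 : (Mᴴ * diagonal (fun i => (p i : ℂ))).submatrix id f
      = (M.submatrix f id)ᴴ * diagonal (fun j => (p (f j) : ℂ)) := by
    ext i j
    simp
  rw [h1, det_mul, det_diagonal, det_conjTranspose, Complex.ofReal_mul, Complex.ofReal_prod,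
    Complex.normSq_eq_conj_mul_self]
  simp only [RCLike.star_def]
  ring

/-- By Cauchy–Binet, `k!` times either determinant is a sum of squared moduli of minors, weighted by
`∏ p (f j)` or by 1. For injective `f` the weight is at most the top product; otherwise a row
repeats and the minor vanishes. -/
theorem re_det_conjTranspose_mul_diagonal_mul_le {k n : ℕ} (hk : k ≤ n) {p : Fin n → ℝ}
    (hp : Antitone p) (hp0 : ∀ i, 0 ≤ p i) (M : Matrix (Fin n) (Fin k) ℂ) :
    (Mᴴ * diagonal (fun i => (p i : ℂ)) * M).det.re
      ≤ (∏ j : Fin k, p (Fin.castLE hk j)) * (Mᴴ * M).det.re := by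
  have hre : ∀ q : Fin n → ℝ, (k.factorial : ℝ) * (Mᴴ * diagonal (fun i => (q i : ℂ)) * M).det.re
      = ∑ f : Fin k → Fin n, (∏ j, q (f j)) * Complex.normSq (M.submatrix f id).det := by
    intro q
    have := congrArg Complex.re (factorial_mul_det_conjTranspose_mul_diagonal_mul q M)
    rwa [Complex.ofReal_re, ← Complex.ofReal_natCast, Complex.re_ofReal_mul] at this
  have h1 := hre fun _ => 1
  simp only [Complex.ofReal_one, diagonal_one, Matrix.mul_one, prod_const_one, one_mul] at h1
  have hfac : (0 : ℝ) < k.factorial := by exact_mod_cast k.factorial_pos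
  refine le_of_mul_le_mul_left ?_ hfac
  rw [hre p, mul_left_comm, h1, mul_sum]
  refine sum_le_sum fun f _ => ?_
  by_cases hf : Function.Injective f
  · exact mul_le_mul_of_nonneg_right (Fin.prod_comp_le_prod_castLE hk hp hp0 hf)
      (Complex.normSq_nonneg _)
  · obtain ⟨i, j, hij, hne⟩ : ∃ i j, f i = f j ∧ i ≠ j := by
      simpa [Function.Injective] using hf
    have : (M.submatrix f id).det = 0 := det_zero_of_row_eq hne (by ext; simp [hij])
    simp [this]

variable {n : ℕ}

theorem re_det_conjTranspose_mul_mul_le {k : ℕ} (hk : k ≤ n) {p : Fin n → ℝ}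
    (hp : Antitone p) (hp0 : ∀ i, 0 ≤ p i) {U : Matrix (Fin n) (Fin n) ℂ}
    (hU : U ∈ unitaryGroup (Fin n) ℂ) (M : Matrix (Fin n) (Fin k) ℂ) :
    (Mᴴ * (U * diagonal (fun i => (p i : ℂ)) * Uᴴ) * M).det.re
      ≤ (∏ j : Fin k, p (Fin.castLE hk j)) * (Mᴴ * M).det.re := by
  have h := re_det_conjTranspose_mul_diagonal_mul_le hk hp hp0 (Uᴴ * M)
  have hUU : U * Uᴴ = 1 := mem_unitaryGroup_iff.1 hU
  have h2 : (Uᴴ * M)ᴴ * (Uᴴ * M) = Mᴴ * M := by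
    rw [conjTranspose_mul, conjTranspose_conjTranspose, Matrix.mul_assoc, ← Matrix.mul_assoc U,
      hUU, Matrix.one_mul]
  rw [h2] at h
  simpa only [conjTranspose_mul, conjTranspose_conjTranspose, Matrix.mul_assoc] using h

theorem submatrix_mem_unitaryGroup {U : Matrix (Fin n) (Fin n) ℂ}
    (hU : U ∈ unitaryGroup (Fin n) ℂ) (σ : Equiv.Perm (Fin n)) :
    U.submatrix id σ ∈ unitaryGroup (Fin n) ℂ := by
  rw [mem_unitaryGroup_iff'] at hU ⊢
  rw [star_eq_conjTranspose] at hU ⊢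
  rw [conjTranspose_submatrix, submatrix_mul _ _ _ id _ Function.bijective_id |>.symm, hU]
  simp

/-- A positive semidefinite matrix, together with all its powers, is diagonalized with its
eigenvalues in decreasing order. -/
theorem PosSemidef.exists_antitone_diagonalization {A : Matrix (Fin n) (Fin n) ℂ}
    (hA : A.PosSemidef) :
    ∃ U ∈ unitaryGroup (Fin n) ℂ, ∃ a : Fin n → ℝ, Antitone a ∧ (∀ i, 0 ≤ a i) ∧
      A = U * diagonal (fun i => (a i : ℂ)) * Uᴴ ∧
      ∀ s : ℝ, A ^ s = U * diagonal (fun i => ((a i ^ s : ℝ) : ℂ)) * Uᴴ := by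
  set V : Matrix (Fin n) (Fin n) ℂ := ↑hA.1.eigenvectorUnitary with hV
  have hVu : V ∈ unitaryGroup (Fin n) ℂ := hA.1.eigenvectorUnitary.2
  set σ : Equiv.Perm (Fin n) := Tuple.sort fun i => -hA.1.eigenvalues i with hσ
  have hconj : ∀ d : Fin n → ℂ, V * diagonal d * Vᴴ
      = V.submatrix id σ * diagonal (d ∘ σ) * (V.submatrix id σ)ᴴ := by
    intro d
    rw [← submatrix_diagonal_equiv d σ, conjTranspose_submatrix, submatrix_mul_equiv,
      submatrix_mul_equiv, submatrix_id_id]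
  have hpow : ∀ s : ℝ, A ^ s = V.submatrix id σ *
      diagonal (fun i => ((hA.1.eigenvalues (σ i) ^ s : ℝ) : ℂ)) * (V.submatrix id σ)ᴴ := by
    intro s
    rw [CFC.rpow_eq_cfc_real (ha := hA.nonneg), hA.1.cfc_eq]
    exact hconj _
  refine ⟨V.submatrix id σ, submatrix_mem_unitaryGroup hVu σ, hA.1.eigenvalues ∘ σ, ?_,
    fun i => hA.eigenvalues_nonneg _, ?_, hpow⟩
  · have := Tuple.monotone_sort fun i => -hA.1.eigenvalues i
    exact fun i j hij => neg_le_neg_iff.1 (this hij)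
  · have := hpow 1
    rw [CFC.rpow_one A hA.nonneg] at this
    simp only [Real.rpow_one] at this
    exact this

theorem conjTranspose_mul_diagonal_mul_castLE {k : ℕ} (hk : k ≤ n)
    {U : Matrix (Fin n) (Fin n) ℂ} (hU : U ∈ unitaryGroup (Fin n) ℂ) (d : Fin n → ℂ) :
    (U.submatrix id (Fin.castLE hk))ᴴ * (U * diagonal d * Uᴴ) * U.submatrix id (Fin.castLE hk)
      = diagonal (fun j => d (Fin.castLE hk j)) := by
  have hUU : Uᴴ * U = 1 := mem_unitaryGroup_iff'.1 hU
  have h : Uᴴ * (U * diagonal d * Uᴴ) * U = diagonal d := by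
    rw [Matrix.mul_assoc U, ← Matrix.mul_assoc, hUU, Matrix.one_mul, Matrix.mul_assoc, hUU,
      Matrix.mul_one]
  have h2 := congrArg (fun X => X.submatrix (Fin.castLE hk) (Fin.castLE hk)) h
  simp only [submatrix_diagonal _ _ (Fin.castLE_injective hk)] at h2
  exact h2

/-- Horn's inequality: the products of the largest eigenvalues of `Y X Y` are at most those of
`Y ^ 2` times those of `X`. -/
theorem prod_castLE_le_of_conj {k : ℕ} (hk : k ≤ n) {x y g : Fin n → ℝ}
    (hx : Antitone x) (hx0 : ∀ i, 0 ≤ x i) (hy : Antitone y) (hy0 : ∀ i, 0 ≤ y i)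
    {U V W X Y : Matrix (Fin n) (Fin n) ℂ} (hU : U ∈ unitaryGroup (Fin n) ℂ)
    (hV : V ∈ unitaryGroup (Fin n) ℂ) (hW : W ∈ unitaryGroup (Fin n) ℂ)
    (hX : X = U * diagonal (fun i => (x i : ℂ)) * Uᴴ) (hYh : Yᴴ = Y)
    (hY : Y * Y = V * diagonal (fun i => (y i : ℂ)) * Vᴴ)
    (hG : Y * X * Y = W * diagonal (fun i => (g i : ℂ)) * Wᴴ) :
    ∏ j : Fin k, g (Fin.castLE hk j)
      ≤ (∏ j : Fin k, x (Fin.castLE hk j)) * ∏ j : Fin k, y (Fin.castLE hk j) := by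
  set T := W.submatrix id (Fin.castLE hk) with hT
  have h1 := conjTranspose_mul_diagonal_mul_castLE hk hW fun i => (g i : ℂ)
  have h2 := conjTranspose_mul_diagonal_mul_castLE hk hW fun _ => 1
  have hWW : W * Wᴴ = 1 := mem_unitaryGroup_iff.1 hW
  rw [diagonal_one, Matrix.mul_one, hWW, Matrix.mul_one, diagonal_one] at h2
  -- The columns of `T` are the top `k` eigenvectors of `Y X Y`. The determinant bound is used
  -- twice: for `X` on `Y T`, then for `Y * Y` on `T`.
  have h3 := re_det_conjTranspose_mul_mul_le hk hx hx0 hU (Y * T)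
  have h4 := re_det_conjTranspose_mul_mul_le hk hy hy0 hV T
  rw [← hX, conjTranspose_mul, hYh] at h3
  rw [← hY, h2, det_one, Complex.one_re, mul_one] at h4
  have h5 : Tᴴ * Y * X * (Y * T) = diagonal (fun j => (g (Fin.castLE hk j) : ℂ)) := by
    rw [← h1, ← hG]
    simp only [Matrix.mul_assoc, hT]
  have h6 : Tᴴ * Y * (Y * T) = Tᴴ * (Y * Y) * T := by simp only [Matrix.mul_assoc]
  rw [h5, h6, det_diagonal, ← Complex.ofReal_prod, Complex.ofReal_re] at h3
  exact h3.trans (mul_le_mul_of_nonneg_left h4 (prod_nonneg fun j _ => hx0 _))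

end Matrix

/-! ### Ky Fan dominance -/

namespace IsUnitarilyInvariantNorm

open Matrix

variable {n : ℕ} {N : Seminorm ℂ (Matrix (Fin n) (Fin n) ℂ)}

theorem map_conj (hN : IsUnitarilyInvariantNorm N) {U : Matrix (Fin n) (Fin n) ℂ}
    (hU : U ∈ unitaryGroup (Fin n) ℂ) (X : Matrix (Fin n) (Fin n) ℂ) : N (U * X * Uᴴ) = N X :=
  hN.map_unitary_mul_mul U hU Uᴴ (Unitary.star_mem hU) X

theorem map_diagonal_comp (hN : IsUnitarilyInvariantNorm N) (d : Fin n → ℂ)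
    (σ : Equiv.Perm (Fin n)) : N (diagonal (d ∘ σ)) = N (diagonal d) := by
  have hP := submatrix_mem_unitaryGroup (one_mem (unitaryGroup (Fin n) ℂ)) σ
  rw [← hN.map_conj hP (diagonal (d ∘ σ)), ← submatrix_diagonal_equiv d σ,
    conjTranspose_submatrix, submatrix_mul_equiv, submatrix_mul_equiv, submatrix_id_id]
  simp

theorem map_diagonal_sign_mul (hN : IsUnitarilyInvariantNorm N) {s : Fin n → ℝ}
    (hs : ∀ i, s i * s i = 1) (d : Fin n → ℝ) :
    N (diagonal fun i => ((s i * d i : ℝ) : ℂ)) = N (diagonal fun i => (d i : ℂ)) := by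
  have hS : diagonal (fun i => (s i : ℂ)) ∈ unitaryGroup (Fin n) ℂ := by
    rw [mem_unitaryGroup_iff, star_eq_conjTranspose, diagonal_conjTranspose,
      diagonal_mul_diagonal, ← diagonal_one]
    congr 1
    ext i
    simp [← Complex.ofReal_mul, hs i]
  have := hN.map_unitary_mul_mul _ hS 1 (one_mem _) (diagonal fun i => (d i : ℂ))
  rw [Matrix.mul_one, diagonal_mul_diagonal] at this
  rw [← this]
  simp

/-- The real-linear functional on diagonal matrices supporting the norm at `x`. -/
theorem exists_support (N : Seminorm ℂ (Matrix (Fin n) (Fin n) ℂ)) (x : Fin n → ℝ) :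
    ∃ f : Fin n → ℝ, ∑ i, f i * x i = N (diagonal fun i => (x i : ℂ)) ∧
      ∀ y : Fin n → ℝ, ∑ i, f i * y i ≤ N (diagonal fun i => (y i : ℂ)) := by
  set φ : (Fin n → ℝ) → ℝ := fun y => N (diagonal fun i => (y i : ℂ)) with hφ
  have hsmul : ∀ (c : ℝ) y, φ (c • y) = |c| * φ y := by
    intro c y
    have : diagonal (fun i => (((c • y) i : ℝ) : ℂ)) = (c : ℂ) • diagonal fun i => (y i : ℂ) := by
      rw [← diagonal_smul]; congr 1; ext i; simp
    simp only [hφ]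
    rw [this, map_smul_eq_mul, Complex.norm_real, Real.norm_eq_abs]
  have hadd : ∀ y z, φ (y + z) ≤ φ y + φ z := by
    intro y z
    have : diagonal (fun i => (((y + z) i : ℝ) : ℂ))
        = diagonal (fun i => (y i : ℂ)) + diagonal fun i => (z i : ℂ) := by
      rw [diagonal_add]; congr 1; ext i; simp
    simp only [hφ]
    rw [this]
    exact map_add_le_add N _ _
  -- Hahn–Banach, extending `c • x ↦ c * φ x` from the line through `x`; `x = 0` spans no line.
  obtain ⟨g, hgx, hg⟩ : ∃ g : (Fin n → ℝ) →ₗ[ℝ] ℝ, g x = φ x ∧ ∀ y, g y ≤ φ y := by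
    by_cases hx : x = 0
    · refine ⟨0, ?_, fun y => apply_nonneg N _⟩
      have := hsmul 0 0
      simpa [hx] using this.symm
    · obtain ⟨g, hg, hgle⟩ := exists_extension_of_le_sublinear
        (LinearPMap.mkSpanSingleton x (φ x) hx) φ
        (fun c hc y => by rw [hsmul, abs_of_pos hc]) hadd (by
          rintro ⟨y, hy⟩
          obtain ⟨c, rfl⟩ := Submodule.mem_span_singleton.1 hy
          have h1 := LinearPMap.mkSpanSingleton'_apply x (φ x)
            (fun c hc => by rw [(smul_eq_zero.1 hc).resolve_right hx, map_zero, zero_smul]) c hy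
          refine (h1.le.trans ?_)
          rw [hsmul, smul_eq_mul]
          exact mul_le_mul_of_nonneg_right (le_abs_self c) (apply_nonneg N _))
      refine ⟨g, ?_, hgle⟩
      have := hg ⟨x, Submodule.mem_span_singleton_self x⟩
      rw [this]
      exact LinearPMap.mkSpanSingleton_apply ℝ ℝ hx (φ x)
  have hrep : ∀ y, ∑ i, g (Pi.single i 1) * y i = g y := by
    intro y
    conv_rhs => rw [pi_eq_sum_univ' y]
    rw [map_sum]
    refine sum_congr rfl fun i _ => ?_
    rw [map_smul, smul_eq_mul, mul_comm]
  exact ⟨fun i => g (Pi.single i 1), by rw [hrep, hgx], fun y => by rw [hrep]; exact hg y⟩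

/-- Ky Fan dominance for diagonal matrices, under weak log-majorization. -/
theorem map_diagonal_le_of_prod_le (hN : IsUnitarilyInvariantNorm N) {x y : Fin n → ℝ}
    (hx : Antitone x) (hx0 : ∀ i, 0 ≤ x i) (hy0 : ∀ i, 0 ≤ y i)
    (h : ∀ k (hk : k ≤ n), ∏ j : Fin k, x (Fin.castLE hk j) ≤ ∏ j : Fin k, y (Fin.castLE hk j)) :
    N (diagonal fun i => (x i : ℂ)) ≤ N (diagonal fun i => (y i : ℂ)) := by
  obtain ⟨f, hfx, hf⟩ := exists_support N x
  set σ : Equiv.Perm (Fin n) := Tuple.sort fun i => -|f i| with hσ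
  have hw : Antitone fun i => |f (σ i)| := fun i j hij =>
    neg_le_neg_iff.1 (Tuple.monotone_sort (fun i => -|f i|) hij)
  set s : Fin n → ℝ := fun i => if 0 ≤ f i then 1 else -1 with hs
  have hss : ∀ i, s i * s i = 1 := fun i => by simp only [hs]; split_ifs <;> norm_num
  have hfs : ∀ i, f i * s i = |f i| := fun i => by
    simp only [hs]
    split_ifs with h0
    · rw [abs_of_nonneg h0, mul_one]
    · rw [abs_of_neg (not_le.1 h0), mul_neg_one]
  have hmono : Monovary (fun i => |f (σ i)|) x := fun i j hij => by
    rcases le_total i j with h1 | h1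
    · exact absurd (hx h1) (not_le.2 hij)
    · exact hw h1
  calc N (diagonal fun i => (x i : ℂ)) = ∑ i, f i * x i := hfx.symm
    _ ≤ ∑ i, |f i| * x i :=
        sum_le_sum fun i _ => mul_le_mul_of_nonneg_right (le_abs_self _) (hx0 i)
    _ = ∑ i, |f (σ (σ.symm i))| * x i := by simp
    -- Rearrangement: both sequences are now decreasing.
    _ ≤ ∑ i, |f (σ i)| * x i := hmono.sum_comp_perm_mul_le_sum_mul
    _ ≤ ∑ i, |f (σ i)| * y i :=
        sum_mul_le_sum_mul_of_prod_le hw (fun i => abs_nonneg _) hx hx0 hy0 h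
    -- The signs and the permutation move onto `y`, where unitary invariance removes them.
    _ = ∑ i, f i * (s i * y (σ.symm i)) := by
        rw [← Equiv.sum_comp σ fun i => f i * (s i * y (σ.symm i))]
        refine sum_congr rfl fun i _ => ?_
        rw [← mul_assoc, hfs, Equiv.symm_apply_apply]
    _ ≤ N (diagonal fun i => ((s i * y (σ.symm i) : ℝ) : ℂ)) :=
        hf fun i => s i * y (σ.symm i)
    _ = N (diagonal fun i => (y (σ.symm i) : ℂ)) :=
        hN.map_diagonal_sign_mul hss fun i => y (σ.symm i)
    _ = N (diagonal fun i => (y i : ℂ)) := hN.map_diagonal_comp (fun i => (y i : ℂ)) σ.symm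

end IsUnitarilyInvariantNorm

/-! ### Optimization over `t` and the main estimate -/

theorem le_rpow_half_mul_rpow_half {x u v : ℝ} (hx : 0 ≤ x) (hu : 0 ≤ u) (hv : 0 ≤ v)
    (h : ∀ t : ℝ, 0 < t → x ≤ (t * u + t⁻¹ * v) / 2) :
    x ≤ u ^ (1 / 2 : ℝ) * v ^ (1 / 2 : ℝ) := by
  -- The hypothesis says `u t² - 2 x t + v ≥ 0` for `t > 0`; for `t ≤ 0` every term is nonnegative.
  -- The discriminant then gives `x² ≤ u v`.
  have hd : discrim u (-(2 * x)) v ≤ 0 := by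
    refine discrim_le_zero fun t => ?_
    rcases le_or_gt t 0 with ht | ht
    · have h1 := mul_nonneg hu (mul_self_nonneg t)
      have h2 := mul_nonneg hx (neg_nonneg.2 ht)
      linarith
    · have h1 := mul_le_mul_of_nonneg_left (h t ht) ht.le
      have h2 : t * ((t * u + t⁻¹ * v) / 2) = (u * (t * t) + v) / 2 := by field_simp
      rw [h2] at h1
      linarith
  rw [discrim] at hd
  rw [← Real.mul_rpow hu hv, ← Real.sqrt_eq_rpow]
  exact Real.le_sqrt_of_sq_le (by linarith)

open Matrix in
theorem map_kappaMean_le {n : ℕ} {N : Seminorm ℂ (Matrix (Fin n) (Fin n) ℂ)}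
    (hN : IsUnitarilyInvariantNorm N) {p : ℝ} (hp : 0 < p) {A B : Matrix (Fin n) (Fin n) ℂ}
    (hA : A.PosSemidef) (hB : B.PosSemidef) {t : ℝ} (ht : 0 < t) :
    N (kappaMean p A B) ≤ (t * N A + t⁻¹ * N B) / 2 := by
  have hApos : (A ^ (p / 4)).PosSemidef := Matrix.nonneg_iff_posSemidef.1 CFC.rpow_nonneg
  have hBpos : (B ^ (p / 2)).PosSemidef := Matrix.nonneg_iff_posSemidef.1 CFC.rpow_nonneg
  have hG : (A ^ (p / 4) * B ^ (p / 2) * A ^ (p / 4)).PosSemidef := by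
    have := hBpos.mul_mul_conjTranspose_same (A ^ (p / 4))
    rwa [hApos.1.eq] at this
  obtain ⟨U, hU, a, ha, ha0, hAeq, hApow⟩ := hA.exists_antitone_diagonalization
  obtain ⟨V, hV, b, hb, hb0, hBeq, hBpow⟩ := hB.exists_antitone_diagonalization
  obtain ⟨W, hW, g, hg, hg0, hGeq, hGpow⟩ := hG.exists_antitone_diagonalization
  have hp2 : 0 ≤ p / 2 := by positivity
  have hp1 : 0 ≤ 1 / p := by positivity
  have hAsq : A ^ (p / 4) * A ^ (p / 4)
      = U * diagonal (fun i => ((a i ^ (p / 2) : ℝ) : ℂ)) * Uᴴ := by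
    have hUU : Uᴴ * U = 1 := mem_unitaryGroup_iff'.1 hU
    have hd : diagonal (fun i => ((a i ^ (p / 4) : ℝ) : ℂ))
        * diagonal (fun i => ((a i ^ (p / 4) : ℝ) : ℂ))
        = diagonal (fun i => ((a i ^ (p / 2) : ℝ) : ℂ)) := by
      rw [diagonal_mul_diagonal]
      congr 1
      ext i
      rw [← Complex.ofReal_mul, ← Real.rpow_add_of_nonneg (ha0 i) (by positivity) (by positivity)]
      congr 2
      ring
    rw [hApow, ← hd]
    simp only [Matrix.mul_assoc]
    rw [← Matrix.mul_assoc Uᴴ U, hUU, Matrix.one_mul]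
  have hprod : ∀ k (hk : k ≤ n), ∏ j : Fin k, g (Fin.castLE hk j) ^ (1 / p)
      ≤ ∏ j : Fin k, (t * a (Fin.castLE hk j) + t⁻¹ * b (Fin.castLE hk j)) / 2 := by
    intro k hk
    -- Horn's inequality with `X = B ^ (p / 2)` and `Y = A ^ (p / 4)`.
    have h1 := prod_castLE_le_of_conj hk
      (fun i j hij => Real.rpow_le_rpow (hb0 j) (hb hij) hp2)
      (fun i => Real.rpow_nonneg (hb0 i) _)
      (fun i j hij => Real.rpow_le_rpow (ha0 j) (ha hij) hp2)
      (fun i => Real.rpow_nonneg (ha0 i) _) hV hU hW (hBpow (p / 2)) hApos.1.eq hAsq hGeq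
    rw [← prod_mul_distrib] at h1
    have h2 := Real.rpow_le_rpow (prod_nonneg fun j _ => hg0 _) h1 hp1
    rw [← Real.finsetProd_rpow _ _ (fun j _ => hg0 _), ← Real.finsetProd_rpow _ _
      (fun j _ => mul_nonneg (Real.rpow_nonneg (hb0 _) _) (Real.rpow_nonneg (ha0 _) _))] at h2
    refine h2.trans (prod_le_prod (fun j _ => by
      have := hb0 (Fin.castLE hk j); have := ha0 (Fin.castLE hk j); positivity) fun j _ => ?_)
    set α := a (Fin.castLE hk j)
    set β := b (Fin.castLE hk j)
    have hα : 0 ≤ α := ha0 _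
    have hβ : 0 ≤ β := hb0 _
    have h3 : p / 2 * (1 / p) = 1 / 2 := by field_simp
    rw [← Real.mul_rpow hβ hα, ← Real.rpow_mul (mul_nonneg hβ hα), h3, ← Real.sqrt_eq_rpow]
    refine Real.sqrt_le_iff.2 ⟨by positivity, ?_⟩
    -- AM–GM for `t α` and `t⁻¹ β`, whose product does not depend on `t`.
    have h4 : (t * α) * (t⁻¹ * β) = β * α := by field_simp
    nlinarith [sq_nonneg (t * α - t⁻¹ * β)]
  have hmain : N (kappaMean p A B)
      ≤ N (diagonal fun i => (((t * a i + t⁻¹ * b i) / 2 : ℝ) : ℂ)) := by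
    rw [kappaMean, hGpow, hN.map_conj hW]
    exact hN.map_diagonal_le_of_prod_le
      (fun i j hij => Real.rpow_le_rpow (hg0 j) (hg hij) hp1)
      (fun i => Real.rpow_nonneg (hg0 i) _)
      (fun i => by have := ha0 i; have := hb0 i; positivity) hprod
  refine hmain.trans ?_
  have hsplit : diagonal (fun i => (((t * a i + t⁻¹ * b i) / 2 : ℝ) : ℂ))
      = ((t / 2 : ℝ) : ℂ) • diagonal (fun i => (a i : ℂ))
        + ((t⁻¹ / 2 : ℝ) : ℂ) • diagonal (fun i => (b i : ℂ)) := by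
    rw [← diagonal_smul, ← diagonal_smul, diagonal_add]
    congr 1
    ext i
    simp only [Pi.smul_apply, smul_eq_mul]
    push_cast
    ring
  have hNA : N A = N (diagonal fun i => (a i : ℂ)) := by
    conv_lhs => rw [hAeq, hN.map_conj hU]
  have hNB : N B = N (diagonal fun i => (b i : ℂ)) := by
    conv_lhs => rw [hBeq, hN.map_conj hV]
  rw [hsplit, hNA, hNB]
  refine (map_add_le_add N _ _).trans (le_of_eq ?_)
  rw [map_smul_eq_mul, map_smul_eq_mul, Complex.norm_real, Complex.norm_real,
    Real.norm_of_nonneg (by positivity), Real.norm_of_nonneg (by positivity)]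
  ring

theorem theorem2p2 {n : ℕ} (N : Seminorm ℂ (Matrix (Fin n) (Fin n) ℂ))
    (hN : IsUnitarilyInvariantNorm N) (p : ℝ) (hp : 0 < p)
    (A B : Matrix (Fin n) (Fin n) ℂ) (hA : A.PosSemidef) (hB : B.PosSemidef) :
    N (kappaMean p A B) ≤ N A ^ (1 / 2 : ℝ) * N B ^ (1 / 2 : ℝ) ∧
      N A ^ (1 / 2 : ℝ) * N B ^ (1 / 2 : ℝ) ≤ (N A + N B) / 2 := by
  have hA0 : 0 ≤ N A := apply_nonneg N A
  have hB0 : 0 ≤ N B := apply_nonneg N B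
  refine ⟨le_rpow_half_mul_rpow_half (apply_nonneg N _) hA0 hB0
    fun t ht => map_kappaMean_le hN hp hA hB ht, ?_⟩
  rw [← Real.mul_rpow hA0 hB0, ← Real.sqrt_eq_rpow]
  exact Real.sqrt_le_iff.2 ⟨by positivity, by nlinarith [sq_nonneg (N A - N B)]⟩
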